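/- Let $n\ge 1$, let $\langle\cdot,\cdot\rangle$ and $\|\cdot\|$ be the Euclidean inner product and norm on $\mathbb{R}^n$, and let $\|\cdot\|_M$ be the associated operator norm on real $n\times n$ matrices. Put $S_+=\{x\in\mathbb{R}^n\setminus\{0\}: x_i\ge 0\ \forall i\}$ and $S_+^o=\{x: x_i>0\ \forall i\}$. For a real $n\times n$ matrix $B$ put $\lambda_B(u,v)=\langle Bu,v\rangle/\langle u,v\rangle$ whenever $\langle u,v\rangle\ne 0$, and define the upper and lower quasi-eigenvalues (a priori in $[-\infty,+\infty]$) $$\overline\lambda_{S_+}(B)=\sup_{u\in S_+}\inf_{v\in S_+^o}\lambda_B(u,v),\qquad \underline\lambda_{S_+}(B)=\inf_{v\in S_+}\sup_{u\in S_+^o}\lambda_B(u,v).$$ A right quasi-eigenvector of $B$ is a $u\in S_+$ with $\overline\lambda_{S_+}(B)=\inf_{v\in S_+^o}\lambda_B(u,v)$; a left quasi-eigenvector is a $v\in S_+$ with $\underline\lambda_{S_+}(B)=\sup_{u\in S_+^o}\lambda_B(u,v)$. A saddle point of $\lambda_B$ is a pair $(u,v)$ of a right and a left quasi-eigenvector with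 $\langle u,v\rangle\neq0$, $\partial_u\lambda_B(u,v)=0$, $\partial_v\lambda_B(u,v)=0$ and $\overline\lambda_{S_+}(B)=\underline\lambda_{S_+}(B)=\lambda_B(u,v)$. Theorem. Let $A$ be an irreducible real $n\times n$ matrix (no simultaneous permutation of rows and columns makes it block upper triangular with two square diagonal blocks of positive size) whose off-diagonal entries are all $\ge 0$ or all $\le 0$. Then there is a real number $\lambda_{S_+}(A)$ with $$\lambda_{S_+}(A)=\overline\lambda_{S_+}(A)=\underline\lambda_{S_+}(A)=\sup_{u\in S_+^o}\inf_{v\in S_+^o}\lambda_A(u,v)=\inf_{v\in S_+^o}\sup_{u\in S_+^o}\lambda_A(u,v),$$ and it is an algebraically simple eigenvalue of $A$. Right and left quasi-eigenvectors of $A$ exist, and for every right quasi-eigenvector $u_{S_+}$ and left quasi-eigenvector $v_{S_+}$ the following holds. (i) All entries of $u_{S_+}$ and $v_{S_+}$ are positive, $Au_{S_+}=\lambda_{S_+}(A)u_{S_+}$ and $A^Tv_{S_+}=\lambda_{S_+}(A)v_{S_+}$. (ii) $(u_{S_+},v_{S_+})$ is a saddle point of $\lambda_A$, and the saddle points of $\lambda_A$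 are exactly the pairs $(a\,u_{S_+},b\,v_{S_+})$ with $a,b>0$. (iii) The numbers $$c_1=\sup_{w\in S_+}\frac{\|w\|\,\|v_{S_+}\|}{\langle w,v_{S_+}\rangle},\qquad c_2=\sup_{w\in S_+}\frac{\|u_{S_+}\|\,\|w\|}{\langle u_{S_+},w\rangle}$$ are finite, and, with $c_0=\max\{c_1,c_2\}$ (which does not depend on $D$), for every real $n\times n$ matrix $D$ both quasi-eigenvalues of $A+D$ are finite and $$\max\{|\underline\lambda_{S_+}(A+D)-\lambda_{S_+}(A)|,\ |\overline\lambda_{S_+}(A+D)-\lambda_{S_+}(A)|\}\le c_0\|D\|_M .$$ Moreover, if all entries of $D$ are $\ge0$, then $\underline\lambda_{S_+}(A+D)\ge\lambda_{S_+}(A)$ and $\overline\lambda_{S_+}(A+D)\ge\lambda_{S_+}(A)$; if all entries of $D$ are $\le0$, then $\underline\lambda_{S_+}(A+D)\le\lambda_{S_+}(A)$ and $\overline\lambda_{S_+}(A+D)\le\lambda_{S_+}(A)$. -/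

import Mathlib

noncomputable section

namespace QuasiEig

/-- The space `ℝⁿ` with its Euclidean inner product. -/
abbrev E (n : ℕ) : Type := EuclideanSpace ℝ (Fin n)

/-- The linear map of `ℝⁿ` given by a real matrix. Its norm is the standard operator norm. -/
abbrev op {n : ℕ} (A : Matrix (Fin n) (Fin n) ℝ) : E n →L[ℝ] E n :=
  Matrix.toEuclideanCLM (𝕜 := ℝ) A

/-- `A` is reducible: a simultaneous permutation of rows and columns brings it into block upper
triangular form with two square diagonal blocks of positive sizes `k` and `n - k`. -/
def Reducible {n : ℕ} (A : Matrix (Fin n) (Fin n) ℝ) : Prop :=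
  ∃ (σ : Equiv.Perm (Fin n)) (k : ℕ), 0 < k ∧ k < n ∧
    ∀ i j : Fin n, k ≤ (i : ℕ) → (j : ℕ) < k → A (σ i) (σ j) = 0

/-- All off-diagonal entries are nonnegative, or all of them are nonpositive. -/
def SignConstantOffDiag {n : ℕ} (A : Matrix (Fin n) (Fin n) ℝ) : Prop :=
  (∀ i j, i ≠ j → 0 ≤ A i j) ∨ (∀ i j, i ≠ j → A i j ≤ 0)

/-- The set of irreducible matrices with sign-constant off-diagonal elements. -/
def Isc {n : ℕ} (A : Matrix (Fin n) (Fin n) ℝ) : Prop :=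
  ¬ Reducible A ∧ SignConstantOffDiag A

/-- The extended Rayleigh quotient `λ(u,v) = ⟨Au, v⟩ / ⟨u, v⟩` (used only where `⟨u, v⟩ ≠ 0`). -/
def rayleigh {n : ℕ} (A : Matrix (Fin n) (Fin n) ℝ) (u v : E n) : ℝ :=
  inner ℝ (op A u) v / inner ℝ u v

/-- The closed nonnegative orthant. Removing the origin gives the cone `S₊`, and the interior
is the open cone of positive vectors. -/
def orthant (n : ℕ) : Set (E n) := {x | ∀ i, 0 ≤ x i}

/-- The upper quasi-eigenvalue `sup_{u ∈ C} inf_{v ∈ C°} λ(u,v)` for a closed cone `K`, where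
`C = K \ {0}` and `C° = int K`. Extended reals are used since the inner infimum may be `-∞`. -/
def upperQ {n : ℕ} (K : Set (E n)) (A : Matrix (Fin n) (Fin n) ℝ) : EReal :=
  ⨆ u ∈ K \ {0}, ⨅ v ∈ interior K, ((rayleigh A u v : ℝ) : EReal)

/-- The lower quasi-eigenvalue `inf_{v ∈ C} sup_{u ∈ C°} λ(u,v)`. -/
def lowerQ {n : ℕ} (K : Set (E n)) (A : Matrix (Fin n) (Fin n) ℝ) : EReal :=
  ⨅ v ∈ K \ {0}, ⨆ u ∈ interior K, ((rayleigh A u v : ℝ) : EReal)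

/-- `u` is a right quasi-eigenvector: `u ∈ C` attains the supremum in the upper
quasi-eigenvalue. -/
def IsRightQuasi {n : ℕ} (K : Set (E n)) (A : Matrix (Fin n) (Fin n) ℝ) (u : E n) : Prop :=
  u ∈ K \ {0} ∧ upperQ K A = ⨅ v ∈ interior K, ((rayleigh A u v : ℝ) : EReal)

/-- `v` is a left quasi-eigenvector: `v ∈ C` attains the infimum in the lower
quasi-eigenvalue. -/
def IsLeftQuasi {n : ℕ} (K : Set (E n)) (A : Matrix (Fin n) (Fin n) ℝ) (v : E n) : Prop :=
  v ∈ K \ {0} ∧ lowerQ K A = ⨆ u ∈ interior K, ((rayleigh A u v : ℝ) : EReal)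

/-- `(u, v)` is a saddle point of `λ(·,·)` in `C × C`: a pair of right and left quasi-eigenvectors
at which `λ(u,v)` is defined, both partial derivatives of `λ` vanish, and the upper and lower
quasi-eigenvalues are equal to `λ(u,v)`. -/
structure IsSaddle {n : ℕ} (K : Set (E n)) (A : Matrix (Fin n) (Fin n) ℝ) (u v : E n) : Prop where
  right : IsRightQuasi K A u
  left : IsLeftQuasi K A v
  inner_ne : inner ℝ u v ≠ 0
  deriv_u : HasFDerivAt (fun x : E n => rayleigh A x v) (0 : E n →L[ℝ] ℝ) u
  deriv_v : HasFDerivAt (fun y : E n => rayleigh A u y) (0 : E n →L[ℝ] ℝ) v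
  upper_eq : upperQ K A = ((rayleigh A u v : ℝ) : EReal)
  lower_eq : lowerQ K A = ((rayleigh A u v : ℝ) : EReal)

end QuasiEig

end

namespace QuasiEig

open Matrix

/-! ### Perron–Frobenius theory for irreducible matrices. -/

section Perron

variable {ι : Type*} [Fintype ι]

/-! Up to sign, a multiple of the identity makes `A` entrywise nonnegative, so Perron's theorem
gives a real `t` with positive eigenvectors `u` of `A` and `v` of `Aᵀ`, each unique up to a factor
(`IsPerron`). Then `λ(u,·)` and `λ(·,v)` are constantly `t` wherever defined. Testing with `u`
bounds every sup-inf and inf-sup below by `t`, and testing with `v` bounds it above, so no minimax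
theorem is needed; the partial derivatives vanish because the functions are locally constant.

Conversely, a right quasi-eigenvector `w` has `λ(w,y) ≥ t` for all positive `y`, so `Aw - tw` is
nonnegative by self-duality of the orthant. It is orthogonal to the positive vector `v`, hence zero,
and `w` is a multiple of `u` (`IsPerron.eq_smul_right`). The left case is symmetric.

For a perturbation, `λ_{A+D}(u,·) = t + λ_D(u,·)` and `λ_{A+D}(·,v) = t + λ_D(·,v)`; the same test
vectors with Cauchy–Schwarz, or with the sign of `D`, give the estimates. -/

lemma mulVec_nonneg {B : Matrix ι ι ℝ} (hB : ∀ i j, 0 ≤ B i j) {z : ι → ℝ}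
    (hz : ∀ i, 0 ≤ z i) (i : ι) : 0 ≤ (B *ᵥ z) i :=
  Finset.sum_nonneg fun j _ => mul_nonneg (hB i j) (hz j)

lemma dotProduct_pos_of_pos [Nonempty ι] {x y : ι → ℝ} (hx : ∀ i, 0 < x i)
    (hy : ∀ i, 0 < y i) : 0 < x ⬝ᵥ y :=
  Finset.sum_pos (fun i _ => mul_pos (hx i) (hy i)) Finset.univ_nonempty

/-- A real eigenvalue with positive left and right eigenvectors, both unique up to factors. -/
structure IsPerron (A : Matrix ι ι ℝ) (t : ℝ) (x y : ι → ℝ) : Prop where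
  right_pos : ∀ i, 0 < x i
  left_pos : ∀ i, 0 < y i
  right_eig : A *ᵥ x = t • x
  left_eig : Aᵀ *ᵥ y = t • y
  right_unique : ∀ w, A *ᵥ w = t • w → ∃ c : ℝ, w = c • x
  left_unique : ∀ w, Aᵀ *ᵥ w = t • w → ∃ c : ℝ, w = c • y

/-- `IsPerron` does not ask `t` to be the largest eigenvalue, so it survives a change of sign. This
covers nonpositive off-diagonal entries. -/
lemma IsPerron.of_neg {A : Matrix ι ι ℝ} {t : ℝ} {x y : ι → ℝ} (h : IsPerron (-A) t x y) :
    IsPerron A (-t) x y where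
  right_pos := h.right_pos
  left_pos := h.left_pos
  right_eig := by rw [neg_smul, ← h.right_eig, neg_mulVec, neg_neg]
  left_eig := by rw [neg_smul, ← h.left_eig, transpose_neg, neg_mulVec, neg_neg]
  right_unique w hw := h.right_unique w (by rw [neg_mulVec, hw, neg_smul, neg_neg])
  left_unique w hw := h.left_unique w (by rw [transpose_neg, neg_mulVec, hw, neg_smul, neg_neg])

variable [DecidableEq ι]

/-- No proper nonempty set of indices is closed under the transitions of `A`. -/
def NoClosedSet (A : Matrix ι ι ℝ) : Prop :=
  ∀ s : Finset ι, s.Nonempty → sᶜ.Nonempty → ∃ i ∈ s, ∃ j ∉ s, A i j ≠ 0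

lemma NoClosedSet.transpose {A : Matrix ι ι ℝ} (h : NoClosedSet A) : NoClosedSet Aᵀ := by
  intro s hs hs'
  obtain ⟨i, hi, j, hj, hij⟩ := h sᶜ hs' (by simpa using hs)
  exact ⟨j, by simpa using hj, i, by simpa using hi, hij⟩

lemma NoClosedSet.congr_offDiag {A B : Matrix ι ι ℝ} (h : NoClosedSet A)
    (hAB : ∀ i j, i ≠ j → A i j ≠ 0 → B i j ≠ 0) : NoClosedSet B := by
  intro s hs hs'
  obtain ⟨i, hi, j, hj, hij⟩ := h s hs hs'
  exact ⟨i, hi, j, hj, hAB i j (fun e => hj (e ▸ hi)) hij⟩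

/-- A nonnegative nonzero vector with a zero entry acquires a positive entry under an
irreducible matrix with nonnegative off-diagonal entries. -/
lemma NoClosedSet.exists_mulVec_pos {A : Matrix ι ι ℝ} (h : NoClosedSet A)
    (hA : ∀ i j, i ≠ j → 0 ≤ A i j) {z : ι → ℝ} (hz : ∀ i, 0 ≤ z i) (hz0 : z ≠ 0)
    (hzp : ¬ ∀ i, 0 < z i) : ∃ i, z i = 0 ∧ 0 < (A *ᵥ z) i := by
  push Not at hzp
  obtain ⟨k, hk⟩ := hzp
  obtain ⟨l, hl⟩ := Function.ne_iff.mp hz0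
  -- The zero set of `z` is proper and nonempty, so some nonzero `A i j` leaves it. Row `i` then has
  -- a positive term at `j`, and its diagonal term, of unknown sign, vanishes since `z i = 0`.
  obtain ⟨i, hi, j, hj, hij⟩ := h (Finset.univ.filter fun i => z i = 0)
    ⟨k, by simpa using le_antisymm hk (hz k)⟩ ⟨l, by simpa using hl⟩
  simp only [Finset.mem_filter, Finset.mem_univ, true_and] at hi hj
  have hne : i ≠ j := by rintro rfl; exact hj hi
  refine ⟨i, hi, ?_⟩
  refine Finset.sum_pos' (fun m _ => ?_) ⟨j, Finset.mem_univ j, ?_⟩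
  · rcases eq_or_ne i m with rfl | hm
    · simp [hi]
    · exact mul_nonneg (hA i m hm) (hz m)
  · exact mul_pos (lt_of_le_of_ne (hA i j hne) hij.symm) (lt_of_le_of_ne (hz j) (Ne.symm hj))

lemma NoClosedSet.eigenvector_pos {A : Matrix ι ι ℝ} (h : NoClosedSet A)
    (hA : ∀ i j, i ≠ j → 0 ≤ A i j) {z : ι → ℝ} (hz : ∀ i, 0 ≤ z i) (hz0 : z ≠ 0)
    {t : ℝ} (hzt : A *ᵥ z = t • z) : ∀ i, 0 < z i := by
  by_contra hzp
  obtain ⟨i, hi, hpos⟩ := h.exists_mulVec_pos hA hz hz0 hzp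
  simp [hzt, hi] at hpos

/-- Iterating `1 + B` makes every nonnegative nonzero vector positive. -/
lemma NoClosedSet.exists_pow_mulVec_pos {B : Matrix ι ι ℝ} (h : NoClosedSet B)
    (hB : ∀ i j, 0 ≤ B i j) (k : ℕ) : ∀ z : ι → ℝ, (∀ i, 0 ≤ z i) → z ≠ 0 →
    (Finset.univ.filter fun i => z i = 0).card ≤ k → ∃ m : ℕ, ∀ i, 0 < ((1 + B) ^ m *ᵥ z) i := by
  induction k with
  | zero =>
    intro z hz hz0 hk
    refine ⟨0, fun i => ?_⟩
    simp only [nonpos_iff_eq_zero, Finset.card_eq_zero, Finset.filter_eq_empty_iff,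
      Finset.mem_univ, true_imp_iff] at hk
    simpa using lt_of_le_of_ne (hz i) (Ne.symm (@hk i))
  | succ k ih =>
    intro z hz hz0 hk
    by_cases hzp : ∀ i, 0 < z i
    · exact ⟨0, by simpa using hzp⟩
    obtain ⟨i, hi, hpos⟩ := h.exists_mulVec_pos (fun i j _ => hB i j) hz hz0 hzp
    -- One factor `1 + B` creates no new zero and removes the one at `i`.
    have hle : ∀ j, z j ≤ ((1 + B) *ᵥ z) j := fun j => by
      simpa [add_mulVec] using mulVec_nonneg hB hz j
    have hi' : 0 < ((1 + B) *ᵥ z) i := by simpa [add_mulVec, hi] using hpos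
    obtain ⟨m, hm⟩ := ih ((1 + B) *ᵥ z) (fun j => (hz j).trans (hle j))
      (fun e => by simp [e] at hi') (by
        refine Nat.le_of_lt_succ (lt_of_lt_of_le (Finset.card_lt_card ?_) hk)
        refine (Finset.ssubset_iff_of_subset fun j hj => ?_).mpr ⟨i, by simpa using hi, ?_⟩
        · simp only [Finset.mem_filter, Finset.mem_univ, true_and] at hj ⊢
          exact le_antisymm (hj ▸ hle j) (hz j)
        · simpa using hi'.ne')
    exact ⟨m + 1, fun j => by rw [pow_succ, ← mulVec_mulVec]; exact hm j⟩

/-- Perron's theorem for an irreducible nonnegative matrix: maximize `t` subject to `t x ≤ B x`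
over the standard simplex. -/
lemma NoClosedSet.exists_eigenvector_of_nonneg [Nonempty ι] {B : Matrix ι ι ℝ}
    (h : NoClosedSet B) (hB : ∀ i j, 0 ≤ B i j) :
    ∃ (t : ℝ) (x : ι → ℝ), (∀ i, 0 < x i) ∧ B *ᵥ x = t • x := by
  set M : ℝ := ∑ i, ∑ j, B i j with hM
  -- Keeping `t` as a coordinate makes the constraint closed, with no quotients `(B x) i / x i` to
  -- define where `x i = 0`.
  let K : Set (ℝ × (ι → ℝ)) :=
    (Set.Icc 0 M ×ˢ stdSimplex ℝ ι) ∩ {p | ∀ i, p.1 * p.2 i ≤ (B *ᵥ p.2) i}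
  have hbound : ∀ (t : ℝ) (x : ι → ℝ), x ∈ stdSimplex ℝ ι → (∀ i, t * x i ≤ (B *ᵥ x) i) →
      t ≤ M := by
    intro t x hx htx
    calc t = ∑ i, t * x i := by rw [← Finset.mul_sum, hx.2, mul_one]
      _ ≤ ∑ i, (B *ᵥ x) i := Finset.sum_le_sum fun i _ => htx i
      _ ≤ M := Finset.sum_le_sum fun i _ => Finset.sum_le_sum fun j _ =>
        mul_le_of_le_one_right (hB i j)
          (hx.2 ▸ Finset.single_le_sum (fun k _ => hx.1 k) (Finset.mem_univ j))
  have hK : IsCompact K := by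
    refine (isCompact_Icc.prod (isCompact_stdSimplex ℝ ι)).inter_right ?_
    simp only [Set.ofPred_forall]
    refine isClosed_iInter fun i => isClosed_le (by fun_prop) ?_
    simp only [mulVec, dotProduct]
    fun_prop
  have hne : K.Nonempty := by
    obtain ⟨i⟩ := ‹Nonempty ι›
    refine ⟨(0, Pi.single i 1), ⟨⟨le_rfl, ?_⟩, single_mem_stdSimplex ℝ i⟩, fun j => ?_⟩
    · exact Finset.sum_nonneg fun i _ => Finset.sum_nonneg fun j _ => hB i j
    · simpa using hB j i
  obtain ⟨⟨t, x⟩, ⟨⟨ht, hx⟩, htx⟩, hmax⟩ := hK.exists_isMaxOn hne continuous_fst.continuousOn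
  simp only [Set.mem_ofPred_eq] at ht hx htx
  have hx0 : x ≠ 0 := by
    rintro rfl
    simpa using hx.2
  suffices hxt : B *ᵥ x = t • x from
    ⟨t, x, h.eigenvector_pos (fun i j _ => hB i j) hx.1 hx0 hxt, hxt⟩
  -- Otherwise the residual `B x - t x` is nonnegative and nonzero, and some `C = (1 + B) ^ m` makes
  -- it positive. As `C` commutes with `B`, the vector `y = C x` satisfies `t y < B y` in every
  -- entry, so `t + ε` is still admissible, against maximality.
  by_contra hxt
  obtain ⟨m, hm⟩ := h.exists_pow_mulVec_pos hB _ (B *ᵥ x - t • x)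
    (fun i => by simpa using htx i) (sub_ne_zero.mpr hxt) le_rfl
  set C := (1 + B) ^ m with hC
  have hBC : Commute B C := ((Commute.one_right B).add_right (Commute.refl B)).pow_right m
  have hCnonneg : ∀ i j, 0 ≤ C i j := by
    rw [hC]
    clear_value C
    clear hm hBC hC
    induction m with
    | zero => intro i j; rw [pow_zero, one_apply]; split_ifs <;> norm_num
    | succ m ih =>
      intro i j
      rw [pow_succ, mul_apply]
      refine Finset.sum_nonneg fun k _ => mul_nonneg (ih i k) ?_
      rw [Matrix.add_apply, one_apply]
      exact add_nonneg (by split_ifs <;> norm_num) (hB k j)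
  set y := C *ᵥ x with hy
  have hyn : ∀ i, 0 ≤ y i := mulVec_nonneg hCnonneg hx.1
  have hyr : ∀ i, 0 < (B *ᵥ y) i - t * y i := by
    intro i
    have := hm i
    rwa [mulVec_sub, mulVec_mulVec, ← hBC.eq, ← mulVec_mulVec, mulVec_smul, ← hy,
      Pi.sub_apply, Pi.smul_apply, smul_eq_mul] at this
  have hev : ∀ᶠ ε in nhdsWithin (0 : ℝ) (Set.Ioi 0), ∀ i, ε * y i < (B *ᵥ y) i - t * y i := by
    refine Filter.eventually_all.mpr fun i => nhdsWithin_le_nhds ?_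
    have : Filter.Tendsto (fun ε : ℝ => ε * y i) (nhds 0) (nhds (0 * y i)) :=
      (continuous_id.mul continuous_const).tendsto 0
    rw [zero_mul] at this
    exact this.eventually_lt_const (hyr i)
  obtain ⟨ε, hε, hε0⟩ := (hev.and self_mem_nhdsWithin).exists
  have hs : 0 < ∑ i, y i := by
    refine lt_of_le_of_ne (Finset.sum_nonneg fun i _ => hyn i) fun e => ?_
    have hy0 : y = 0 := funext fun i =>
      (Finset.sum_eq_zero_iff_of_nonneg fun i _ => hyn i).mp e.symm i (Finset.mem_univ i)
    obtain ⟨i⟩ := ‹Nonempty ι›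
    simpa [hy0] using hyr i
  set w := (∑ i, y i)⁻¹ • y with hw
  have hwS : w ∈ stdSimplex ℝ ι := by
    refine ⟨fun i => mul_nonneg (inv_nonneg.mpr hs.le) (hyn i), ?_⟩
    simp only [hw, Pi.smul_apply, smul_eq_mul, ← Finset.mul_sum]
    exact inv_mul_cancel₀ hs.ne'
  have hwt : ∀ i, (t + ε) * w i ≤ (B *ᵥ w) i := by
    intro i
    rw [hw, mulVec_smul, Pi.smul_apply, Pi.smul_apply, smul_eq_mul, smul_eq_mul, mul_left_comm]
    exact mul_le_mul_of_nonneg_left (by linarith [hε i]) (inv_nonneg.mpr hs.le)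
  have hε0' : 0 < ε := hε0
  have hmem : (t + ε, w) ∈ K :=
    ⟨⟨⟨by linarith [ht.1], hbound _ _ hwS hwt⟩, hwS⟩, hwt⟩
  have := hmax hmem
  simp only [Set.mem_ofPred_eq] at this
  linarith

lemma NoClosedSet.exists_eigenvector [Nonempty ι] {A : Matrix ι ι ℝ} (h : NoClosedSet A)
    (hA : ∀ i j, i ≠ j → 0 ≤ A i j) :
    ∃ (t : ℝ) (x : ι → ℝ), (∀ i, 0 < x i) ∧ A *ᵥ x = t • x := by
  -- This shift makes every diagonal entry nonnegative.
  set c : ℝ := ∑ i, |A i i|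
  have hB : NoClosedSet (A + c • (1 : Matrix ι ι ℝ)) :=
    h.congr_offDiag fun i j hij => by simp [one_apply, hij]
  obtain ⟨t, x, hx, hxt⟩ := hB.exists_eigenvector_of_nonneg fun i j => by
    rcases eq_or_ne i j with rfl | hij
    · have := Finset.single_le_sum (f := fun i => |A i i|) (fun k _ => abs_nonneg _)
        (Finset.mem_univ i)
      simp only [Matrix.add_apply, Matrix.smul_apply, one_apply_eq, smul_eq_mul, mul_one]
      linarith [neg_abs_le (A i i)]
    · simpa [one_apply, hij] using hA i j hij
  refine ⟨t - c, x, hx, ?_⟩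
  rw [add_mulVec, smul_mulVec, one_mulVec] at hxt
  rw [sub_smul, ← hxt, add_sub_cancel_right]

/-- Subtract the largest multiple of `x` that keeps the difference nonnegative. The result has a
zero entry, so as an eigenvector it must vanish. -/
lemma NoClosedSet.eigenvector_unique [Nonempty ι] {A : Matrix ι ι ℝ} (h : NoClosedSet A)
    (hA : ∀ i j, i ≠ j → 0 ≤ A i j) {t : ℝ} {x w : ι → ℝ} (hx : ∀ i, 0 < x i)
    (hxt : A *ᵥ x = t • x) (hwt : A *ᵥ w = t • w) : ∃ c : ℝ, w = c • x := by
  obtain ⟨i, hi⟩ := Finite.exists_min fun i => w i / x i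
  refine ⟨w i / x i, ?_⟩
  by_contra hne
  have := h.eigenvector_pos hA (z := w - (w i / x i) • x) (t := t)
    (fun j => by simpa using (le_div_iff₀ (hx j)).mp (hi j)) (sub_ne_zero.mpr hne)
    (by rw [mulVec_sub, mulVec_smul, hxt, hwt, smul_sub, smul_comm]) i
  simp [(hx i).ne'] at this

lemma NoClosedSet.exists_isPerron [Nonempty ι] {A : Matrix ι ι ℝ} (h : NoClosedSet A)
    (hA : ∀ i j, i ≠ j → 0 ≤ A i j) : ∃ t x y, IsPerron A t x y := by
  have hA' : ∀ i j, i ≠ j → 0 ≤ Aᵀ i j := fun i j hij => hA j i hij.symm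
  obtain ⟨t, x, hx, hxt⟩ := h.exists_eigenvector hA
  obtain ⟨s, y, hy, hys⟩ := h.transpose.exists_eigenvector hA'
  -- Evaluate `y ⬝ᵥ A x` from both sides and divide by `y ⬝ᵥ x > 0`.
  have hts : t = s := by
    have h1 : y ⬝ᵥ A *ᵥ x = t * (y ⬝ᵥ x) := by rw [hxt, dotProduct_smul, smul_eq_mul]
    have h2 : y ⬝ᵥ A *ᵥ x = s * (y ⬝ᵥ x) := by
      rw [dotProduct_mulVec, ← mulVec_transpose, hys, smul_dotProduct, smul_eq_mul]
    exact mul_right_cancel₀ (dotProduct_pos_of_pos hy hx).ne' (h1.symm.trans h2)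
  subst hts
  exact ⟨t, x, y, hx, hy, hxt, hys, fun w hw => h.eigenvector_unique hA hx hxt hw,
    fun w hw => h.transpose.eigenvector_unique hA' hy hys hw⟩

/-- The multiplicity is the dimension of the maximal generalized eigenspace. There is no Jordan
chain of length two: if `(A - t) w = c x`, pairing with `y` gives `0 = c (y ⬝ᵥ x)`, so `c = 0`. -/
lemma IsPerron.rootMultiplicity_charpoly [Nonempty ι] {A : Matrix ι ι ℝ} {t : ℝ}
    {x y : ι → ℝ} (h : IsPerron A t x y) : A.charpoly.rootMultiplicity t = 1 := by
  have hxy := dotProduct_pos_of_pos h.left_pos h.right_pos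
  have hx0 : x ≠ 0 := by
    rintro rfl
    simp at hxy
  rw [← charpoly_toLin', ← LinearMap.finrank_maxGenEigenspace_eq]
  have hgen : ∀ (k : ℕ) (w : ι → ℝ), ((A.toLin' - t • (1 : Module.End ℝ (ι → ℝ))) ^ k) w = 0 →
      w ∈ Submodule.span ℝ {x} := by
    intro k
    induction k with
    | zero => intro w hw; simp_all
    | succ k ih =>
      intro w hw
      rw [pow_succ, Module.End.mul_apply] at hw
      obtain ⟨c, hc⟩ := Submodule.mem_span_singleton.mp (ih _ hw)
      have hc' : A *ᵥ w - t • w = c • x := by simpa using hc.symm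
      have hyw : y ⬝ᵥ (A *ᵥ w - t • w) = 0 := by
        rw [dotProduct_sub, dotProduct_mulVec, ← mulVec_transpose, h.left_eig, smul_dotProduct,
          dotProduct_smul, sub_self]
      rw [hc', dotProduct_smul, smul_eq_mul, mul_eq_zero, or_iff_left hxy.ne'] at hyw
      rw [hyw, zero_smul, sub_eq_zero] at hc'
      obtain ⟨d, rfl⟩ := h.right_unique w hc'
      exact Submodule.smul_mem _ _ (Submodule.mem_span_singleton_self x)
  have : Module.End.maxGenEigenspace A.toLin' t = Submodule.span ℝ {x} := by
    apply le_antisymm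
    · intro w hw
      obtain ⟨k, hk⟩ := Module.End.mem_maxGenEigenspace _ _ _ |>.mp hw
      exact hgen k w hk
    · rw [Submodule.span_singleton_le_iff_mem]
      refine Module.End.mem_maxGenEigenspace _ _ _ |>.mpr ⟨1, ?_⟩
      simp [h.right_eig]
  rw [this, finrank_span_singleton hx0]

end Perron

/-- A permutation sending the first `sᶜ.card` positions onto `sᶜ`, and the rest onto `s`, turns a
closed set `s` into a vanishing lower-left block. -/
lemma noClosedSet_of_not_reducible {n : ℕ} {A : Matrix (Fin n) (Fin n) ℝ} (hA : ¬ Reducible A) :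
    NoClosedSet A := by
  intro s hs hs'
  by_contra! hzero
  apply hA
  have hcard : sᶜ.card + s.card = n := by simp
  have hc : Fintype.card {i : Fin n // (i : ℕ) < sᶜ.card} = Fintype.card {i // i ∈ sᶜ} := by
    rw [Fintype.card_coe, Fintype.card_subtype]
    have := Fin.card_filter_val_lt (n := n) (m := sᶜ.card)
    omega
  let e := Fintype.equivOfCardEq hc
  refine ⟨e.extendSubtype, sᶜ.card, hs'.card_pos, by have := hs.card_pos; omega, ?_⟩
  intro i j hi hj
  refine hzero _ ?_ _ ?_
  · simpa using e.extendSubtype_not_mem i (by simpa using hi)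
  · simpa only [Finset.mem_compl] using e.extendSubtype_mem j hj

lemma Isc.exists_isPerron {n : ℕ} (hn : 0 < n) {A : Matrix (Fin n) (Fin n) ℝ} (hA : Isc A) :
    ∃ t x y, IsPerron A t x y := by
  have : Nonempty (Fin n) := ⟨⟨0, hn⟩⟩
  have hirr := noClosedSet_of_not_reducible hA.1
  rcases hA.2 with h | h
  · exact hirr.exists_isPerron h
  · obtain ⟨t, x, y, hxy⟩ := (hirr.congr_offDiag (B := -A) fun i j _ => by simp).exists_isPerron
      fun i j hij => by simpa using h i j hij
    exact ⟨-t, x, y, hxy.of_neg⟩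

/-! ### The orthant, its interior and Rayleigh quotients. -/

section Quotients

variable {n : ℕ}

lemma op_eq_smul_iff {A : Matrix (Fin n) (Fin n) ℝ} {u : E n} {t : ℝ} :
    op A u = t • u ↔ A *ᵥ u.ofLp = t • u.ofLp := by
  simp [← (WithLp.ofLp_injective 2).eq_iff]

lemma inner_eq_dotProduct (u v : E n) : inner ℝ u v = u.ofLp ⬝ᵥ v.ofLp := by
  simp [PiLp.inner_apply, dotProduct, mul_comm]

lemma inner_op_left (A : Matrix (Fin n) (Fin n) ℝ) (u v : E n) :
    inner ℝ (op A u) v = inner ℝ u (op A.transpose v) := by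
  rw [inner_eq_dotProduct, inner_eq_dotProduct, Matrix.ofLp_toEuclideanCLM,
    Matrix.ofLp_toEuclideanCLM, mulVec_transpose, dotProduct_comm, dotProduct_mulVec,
    dotProduct_comm]

lemma interior_orthant : interior (orthant n) = {x | ∀ i, 0 < x i} := by
  have : orthant n = (EuclideanSpace.equiv (Fin n) ℝ).toHomeomorph ⁻¹'
      (Set.univ.pi fun _ => Set.Ici 0) := by
    ext x
    simp only [Set.mem_preimage, Set.mem_pi, Set.mem_univ, true_imp_iff, Set.mem_Ici]
    rfl
  rw [this, ← Homeomorph.preimage_interior, interior_pi_set Set.finite_univ]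
  ext x
  simp only [interior_Ici, Set.mem_preimage, Set.mem_pi, Set.mem_univ, true_imp_iff, Set.mem_Ioi]
  rfl

lemma mem_interior_orthant {x : E n} : x ∈ interior (orthant n) ↔ ∀ i, 0 < x i := by
  rw [interior_orthant]
  rfl

lemma inner_pos {u v : E n} (hu : u ∈ orthant n \ {0}) (hv : v ∈ interior (orthant n)) :
    0 < inner ℝ u v := by
  rw [mem_interior_orthant] at hv
  obtain ⟨i, hi⟩ : ∃ i, u i ≠ 0 := by
    by_contra! h
    exact hu.2 (by ext i; exact h i)
  rw [inner_eq_dotProduct]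
  exact Finset.sum_pos' (fun j _ => mul_nonneg (hu.1 j) (hv j).le)
    ⟨i, Finset.mem_univ i, mul_pos (lt_of_le_of_ne (hu.1 i) hi.symm) (hv i)⟩

lemma inner_pos' {u v : E n} (hu : u ∈ interior (orthant n)) (hv : v ∈ orthant n \ {0}) :
    0 < inner ℝ u v := by
  rw [real_inner_comm]
  exact inner_pos hv hu

lemma interior_orthant_subset [Nonempty (Fin n)] : interior (orthant n) ⊆ orthant n \ {0} := by
  intro x hx
  refine ⟨interior_subset hx, ?_⟩
  rintro rfl
  obtain ⟨i⟩ := ‹Nonempty (Fin n)›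
  simpa using mem_interior_orthant.mp hx i

lemma smul_mem_interior_orthant {x : E n} (hx : x ∈ interior (orthant n)) {a : ℝ} (ha : 0 < a) :
    a • x ∈ interior (orthant n) := by
  rw [mem_interior_orthant] at hx ⊢
  exact fun i => mul_pos ha (hx i)

/-- The nonnegative orthant is self-dual. -/
lemma mem_orthant_of_inner_nonneg {w : E n}
    (hw : ∀ v ∈ interior (orthant n), 0 ≤ inner ℝ w v) : w ∈ orthant n := by
  intro i
  -- Test with `e_i + ε (1, …, 1)`, which is positive, then let `ε → 0`.
  have key : ∀ ε : ℝ, 0 < ε → 0 ≤ w i + ε * ∑ j, w j := by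
    intro ε hε
    have := hw (WithLp.toLp 2 (Pi.single i 1 + fun _ => ε)) (mem_interior_orthant.mpr fun j => by
      have : (0 : ℝ) ≤ (Pi.single i 1 : Fin n → ℝ) j := by
        rw [Pi.single_apply]; split_ifs <;> norm_num
      simpa using by linarith)
    rw [inner_eq_dotProduct, dotProduct_add, dotProduct_single_one] at this
    simpa [dotProduct, ← Finset.sum_mul, mul_comm ε] using this
  have hlim : Filter.Tendsto (fun ε : ℝ => w i + ε * ∑ j, w j) (nhdsWithin 0 (Set.Ioi 0))
      (nhds (w i + 0 * ∑ j, w j)) :=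
    ((continuous_const.add (continuous_id.mul continuous_const)).tendsto 0).mono_left
      nhdsWithin_le_nhds
  rw [zero_mul, add_zero] at hlim
  exact ge_of_tendsto hlim (Filter.eventually_of_mem self_mem_nhdsWithin fun ε hε => key ε hε)

/-- In these four bounds a test vector `u` bounds from below and a test vector `v` from above. A
test vector for the inner variable must be positive, which is why positivity of both Perron vectors
matters. -/
lemma le_upperQ {A : Matrix (Fin n) (Fin n) ℝ} {u : E n} (hu : u ∈ orthant n \ {0}) {c : ℝ}
    (h : ∀ v ∈ interior (orthant n), c ≤ rayleigh A u v) :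
    (c : EReal) ≤ upperQ (orthant n) A :=
  le_iSup₂_of_le u hu (le_iInf₂ fun v hv => EReal.coe_le_coe_iff.mpr (h v hv))

lemma upperQ_le {A : Matrix (Fin n) (Fin n) ℝ} {v : E n} (hv : v ∈ interior (orthant n)) {c : ℝ}
    (h : ∀ u ∈ orthant n \ {0}, rayleigh A u v ≤ c) : upperQ (orthant n) A ≤ (c : EReal) :=
  iSup₂_le fun u hu => iInf₂_le_of_le v hv (EReal.coe_le_coe_iff.mpr (h u hu))

lemma lowerQ_le {A : Matrix (Fin n) (Fin n) ℝ} {v : E n} (hv : v ∈ orthant n \ {0}) {c : ℝ}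
    (h : ∀ u ∈ interior (orthant n), rayleigh A u v ≤ c) :
    lowerQ (orthant n) A ≤ (c : EReal) :=
  iInf₂_le_of_le v hv (iSup₂_le fun u hu => EReal.coe_le_coe_iff.mpr (h u hu))

lemma le_lowerQ {A : Matrix (Fin n) (Fin n) ℝ} {u : E n} (hu : u ∈ interior (orthant n)) {c : ℝ}
    (h : ∀ v ∈ orthant n \ {0}, c ≤ rayleigh A u v) : (c : EReal) ≤ lowerQ (orthant n) A :=
  le_iInf₂ fun v hv => le_iSup₂_of_le u hu (EReal.coe_le_coe_iff.mpr (h v hv))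

lemma rayleigh_add_of_right {A : Matrix (Fin n) (Fin n) ℝ} (D : Matrix (Fin n) (Fin n) ℝ)
    {t : ℝ} {u v : E n} (hu : op A u = t • u) (huv : inner ℝ u v ≠ (0 : ℝ)) :
    rayleigh (A + D) u v = t + rayleigh D u v := by
  rw [rayleigh, op, map_add, _root_.add_apply, hu, inner_add_left, real_inner_smul_left,
    add_div, mul_div_cancel_right₀ _ huv, rayleigh]

lemma rayleigh_transpose (A : Matrix (Fin n) (Fin n) ℝ) (u v : E n) :
    rayleigh A.transpose v u = rayleigh A u v := by
  rw [rayleigh, rayleigh, inner_op_left, transpose_transpose, real_inner_comm, real_inner_comm u v]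

lemma rayleigh_add_of_left {A : Matrix (Fin n) (Fin n) ℝ} (D : Matrix (Fin n) (Fin n) ℝ)
    {t : ℝ} {u v : E n} (hv : op A.transpose v = t • v) (huv : inner ℝ u v ≠ (0 : ℝ)) :
    rayleigh (A + D) u v = t + rayleigh D u v := by
  rw [← rayleigh_transpose, transpose_add,
    rayleigh_add_of_right _ hv (by rwa [real_inner_comm]), rayleigh_transpose]

lemma rayleigh_of_right {A : Matrix (Fin n) (Fin n) ℝ} {t : ℝ} {u v : E n}
    (hu : op A u = t • u) (huv : inner ℝ u v ≠ (0 : ℝ)) : rayleigh A u v = t := by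
  rw [rayleigh, hu, real_inner_smul_left, mul_div_cancel_right₀ _ huv]

lemma rayleigh_of_left {A : Matrix (Fin n) (Fin n) ℝ} {t : ℝ} {u v : E n}
    (hv : op A.transpose v = t • v) (huv : inner ℝ u v ≠ (0 : ℝ)) : rayleigh A u v = t := by
  rw [← rayleigh_transpose, rayleigh_of_right hv (by rwa [real_inner_comm])]

lemma abs_rayleigh_le (D : Matrix (Fin n) (Fin n) ℝ) {u v : E n} (huv : 0 < inner ℝ u v) :
    |rayleigh D u v| ≤ ‖u‖ * ‖v‖ / inner ℝ u v * ‖op D‖ := by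
  rw [rayleigh, abs_div, abs_of_pos huv, div_mul_eq_mul_div]
  gcongr
  calc |inner ℝ (op D u) v| ≤ ‖op D u‖ * ‖v‖ := abs_real_inner_le_norm _ _
    _ ≤ (‖op D‖ * ‖u‖) * ‖v‖ := by gcongr; exact (op D).le_opNorm u
    _ = ‖u‖ * ‖v‖ * ‖op D‖ := by ring

lemma rayleigh_nonneg {D : Matrix (Fin n) (Fin n) ℝ} (hD : ∀ i j, 0 ≤ D i j) {u v : E n}
    (hu : u ∈ orthant n) (hv : v ∈ orthant n) : 0 ≤ rayleigh D u v := by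
  rw [rayleigh, inner_eq_dotProduct, inner_eq_dotProduct]
  exact div_nonneg (Finset.sum_nonneg fun i _ => mul_nonneg (mulVec_nonneg hD hu i) (hv i))
    (Finset.sum_nonneg fun i _ => mul_nonneg (hu i) (hv i))

lemma rayleigh_neg (D : Matrix (Fin n) (Fin n) ℝ) (u v : E n) :
    rayleigh (-D) u v = -rayleigh D u v := by
  rw [rayleigh, op, map_neg, _root_.neg_apply, inner_neg_left, neg_div, rayleigh]

lemma norm_le_sum {w : E n} (hw : w ∈ orthant n) : ‖w‖ ≤ ∑ i, w i := by
  rw [EuclideanSpace.norm_eq]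
  refine Real.sqrt_le_iff.mpr ⟨Finset.sum_nonneg fun i _ => hw i, ?_⟩
  simp only [Real.norm_eq_abs, sq_abs]
  exact Finset.sum_sq_le_sq_sum_of_nonneg fun i _ => hw i

/-- The secant of the angle with a fixed positive vector is bounded on the orthant. -/
lemma exists_isLUB_secant [Nonempty (Fin n)] {v : E n} (hv : v ∈ interior (orthant n)) :
    ∃ c, IsLUB ((fun w : E n => ‖w‖ * ‖v‖ / inner ℝ w v) '' (orthant n \ {0})) c := by
  refine ⟨_, isLUB_csSup (Set.Nonempty.image _ ⟨v, interior_orthant_subset hv⟩) ?_⟩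
  -- With `v i` the least entry, `⟨w, v⟩ ≥ v i * ∑ w j ≥ v i * ‖w‖`, hence the bound `‖v‖ / v i`.
  obtain ⟨i, hi⟩ := Finite.exists_min fun i => v i
  have hvi := mem_interior_orthant.mp hv i
  refine ⟨‖v‖ / v i, ?_⟩
  rintro _ ⟨w, hw, rfl⟩
  dsimp only
  rw [div_le_div_iff₀ (inner_pos hw hv) hvi]
  have : ‖w‖ * v i ≤ inner ℝ w v := by
    rw [inner_eq_dotProduct]
    calc ‖w‖ * v i ≤ (∑ j, w j) * v i := by gcongr; exact norm_le_sum hw.1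
      _ = ∑ j, w j * v i := Finset.sum_mul _ _ _
      _ ≤ ∑ j, w j * v j := Finset.sum_le_sum fun j _ => mul_le_mul_of_nonneg_left (hi j) (hw.1 j)
  calc ‖w‖ * ‖v‖ * v i = ‖v‖ * (‖w‖ * v i) := by ring
    _ ≤ ‖v‖ * inner ℝ w v := by gcongr

end Quotients

/-! ### Consequences of a Perron pair: quasi-eigenvalues, saddle points, perturbations. -/

section PerronPair

variable {n : ℕ} {A : Matrix (Fin n) (Fin n) ℝ} {t : ℝ} {u v : E n}

lemma IsPerron.right_mem (h : IsPerron A t u.ofLp v.ofLp) : u ∈ interior (orthant n) :=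
  mem_interior_orthant.mpr h.right_pos

lemma IsPerron.left_mem (h : IsPerron A t u.ofLp v.ofLp) : v ∈ interior (orthant n) :=
  mem_interior_orthant.mpr h.left_pos

lemma IsPerron.op_right (h : IsPerron A t u.ofLp v.ofLp) : op A u = t • u :=
  op_eq_smul_iff.mpr h.right_eig

lemma IsPerron.op_left (h : IsPerron A t u.ofLp v.ofLp) : op A.transpose v = t • v :=
  op_eq_smul_iff.mpr h.left_eig

lemma IsPerron.transpose (h : IsPerron A t u.ofLp v.ofLp) :
    IsPerron A.transpose t v.ofLp u.ofLp where
  right_pos := h.left_pos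
  left_pos := h.right_pos
  right_eig := h.left_eig
  left_eig := h.right_eig
  right_unique := h.left_unique
  left_unique := h.right_unique

/-- Real bounds on both sides exclude `±∞`; this is where finiteness of the perturbed
quasi-eigenvalues comes from. -/
lemma exists_abs_sub_le_of_mem_Icc {q : EReal} {c₁ c₂ d : ℝ} (hd : 0 ≤ d)
    (hl : ((t + -(c₂ * d) : ℝ) : EReal) ≤ q) (hu : q ≤ ((t + c₁ * d : ℝ) : EReal)) :
    ∃ r : ℝ, q = (r : EReal) ∧ |r - t| ≤ max c₁ c₂ * d := by
  induction q with
  | bot => exact absurd hl (EReal.bot_lt_coe _).not_ge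
  | top => exact absurd hu (EReal.coe_lt_top _).not_ge
  | coe r =>
    rw [EReal.coe_le_coe_iff] at hl hu
    refine ⟨r, rfl, abs_le.mpr ⟨?_, ?_⟩⟩
    · linarith [mul_le_mul_of_nonneg_right (le_max_right c₁ c₂) hd]
    · linarith [mul_le_mul_of_nonneg_right (le_max_left c₁ c₂) hd]

lemma IsPerron.rayleigh_right (h : IsPerron A t u.ofLp v.ofLp) {w : E n}
    (hw : w ∈ orthant n \ {0}) : rayleigh A u w = t :=
  rayleigh_of_right h.op_right (inner_pos' h.right_mem hw).ne'

lemma IsPerron.rayleigh_left (h : IsPerron A t u.ofLp v.ofLp) {w : E n}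
    (hw : w ∈ orthant n \ {0}) : rayleigh A w v = t :=
  rayleigh_of_left h.op_left (inner_pos hw h.left_mem).ne'

lemma IsPerron.smul (h : IsPerron A t u.ofLp v.ofLp) {a b : ℝ} (ha : 0 < a) (hb : 0 < b) :
    IsPerron A t (a • u).ofLp (b • v).ofLp where
  right_pos := mem_interior_orthant.mp (smul_mem_interior_orthant h.right_mem ha)
  left_pos := mem_interior_orthant.mp (smul_mem_interior_orthant h.left_mem hb)
  right_eig := op_eq_smul_iff.mp (by rw [map_smul, h.op_right, smul_comm])
  left_eig := op_eq_smul_iff.mp (by rw [map_smul, h.op_left, smul_comm])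
  right_unique w hw := by
    obtain ⟨c, rfl⟩ := h.right_unique w hw
    exact ⟨c / a, by rw [WithLp.ofLp_smul, smul_smul, div_mul_cancel₀ _ ha.ne']⟩
  left_unique w hw := by
    obtain ⟨c, rfl⟩ := h.left_unique w hw
    exact ⟨c / b, by rw [WithLp.ofLp_smul, smul_smul, div_mul_cancel₀ _ hb.ne']⟩

variable [Nonempty (Fin n)]

/-- Any nonnegative `w` with `t w ≤ A w` is a positive multiple of the Perron eigenvector. -/
lemma IsPerron.eq_smul_right (h : IsPerron A t u.ofLp v.ofLp) {w : E n}
    (hw : w ∈ orthant n \ {0}) (hwt : op A w - t • w ∈ orthant n) :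
    ∃ a : ℝ, 0 < a ∧ w = a • u := by
  -- The nonnegative residual has zero inner product with the positive `v`, because `Aᵀ v = t v`.
  have hz : op A w = t • w := by
    rw [← sub_eq_zero]
    by_contra hne
    have := inner_pos ⟨hwt, hne⟩ h.left_mem
    rw [inner_sub_left, inner_op_left, h.op_left, real_inner_smul_left, real_inner_smul_right,
      sub_self] at this
    exact this.false
  obtain ⟨a, ha⟩ := h.right_unique _ (op_eq_smul_iff.mp hz)
  have hwu : w = a • u := WithLp.ofLp_injective 2 ha
  refine ⟨a, ?_, hwu⟩
  have := inner_pos hw h.left_mem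
  rw [hwu, real_inner_smul_left] at this
  exact pos_of_mul_pos_left this (inner_pos' h.right_mem (interior_orthant_subset h.left_mem)).le

/-- The left counterpart, for `Aᵀ w ≤ t w`. -/
lemma IsPerron.eq_smul_left (h : IsPerron A t u.ofLp v.ofLp) {w : E n}
    (hw : w ∈ orthant n \ {0}) (hwt : t • w - op A.transpose w ∈ orthant n) :
    ∃ a : ℝ, 0 < a ∧ w = a • v := by
  -- Passing to `-Aᵀ` and `-t` reverses the inequality, so the right-hand version applies.
  have hneg : IsPerron (-A.transpose) (-t) v.ofLp u.ofLp :=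
    IsPerron.of_neg (by rw [neg_neg]; exact h.transpose)
  refine hneg.eq_smul_right hw ?_
  rwa [op, map_neg, _root_.neg_apply, neg_smul, sub_neg_eq_add, neg_add_eq_sub]

lemma IsPerron.iInf_rayleigh (h : IsPerron A t u.ofLp v.ofLp) :
    ⨅ w ∈ interior (orthant n), ((rayleigh A u w : ℝ) : EReal) = (t : EReal) :=
  le_antisymm
    (iInf₂_le_of_le v h.left_mem (by rw [h.rayleigh_right (interior_orthant_subset h.left_mem)]))
    (le_iInf₂ fun w hw => by rw [h.rayleigh_right (interior_orthant_subset hw)])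

lemma IsPerron.iSup_rayleigh (h : IsPerron A t u.ofLp v.ofLp) :
    ⨆ w ∈ interior (orthant n), ((rayleigh A w v : ℝ) : EReal) = (t : EReal) :=
  le_antisymm
    (iSup₂_le fun w hw => by rw [h.rayleigh_left (interior_orthant_subset hw)])
    (le_iSup₂_of_le u h.right_mem
      (by rw [h.rayleigh_left (interior_orthant_subset h.right_mem)]))

lemma IsPerron.upperQ_eq (h : IsPerron A t u.ofLp v.ofLp) :
    upperQ (orthant n) A = (t : EReal) :=
  le_antisymm (upperQ_le h.left_mem fun _ hw => (h.rayleigh_left hw).le)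
    (le_upperQ (interior_orthant_subset h.right_mem) fun _ hw =>
      (h.rayleigh_right (interior_orthant_subset hw)).ge)

lemma IsPerron.lowerQ_eq (h : IsPerron A t u.ofLp v.ofLp) :
    lowerQ (orthant n) A = (t : EReal) :=
  le_antisymm (lowerQ_le (interior_orthant_subset h.left_mem) fun _ hw =>
      (h.rayleigh_left (interior_orthant_subset hw)).le)
    (le_lowerQ h.right_mem fun _ hw => (h.rayleigh_right hw).ge)

lemma IsPerron.iSup_iInf_rayleigh (h : IsPerron A t u.ofLp v.ofLp) :
    (⨆ u ∈ interior (orthant n), ⨅ v ∈ interior (orthant n),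
      ((rayleigh A u v : ℝ) : EReal)) = (t : EReal) :=
  le_antisymm
    (iSup₂_le fun w hw => iInf₂_le_of_le v h.left_mem
      (by rw [h.rayleigh_left (interior_orthant_subset hw)]))
    (le_iSup₂_of_le u h.right_mem h.iInf_rayleigh.ge)

lemma IsPerron.iInf_iSup_rayleigh (h : IsPerron A t u.ofLp v.ofLp) :
    (⨅ v ∈ interior (orthant n), ⨆ u ∈ interior (orthant n),
      ((rayleigh A u v : ℝ) : EReal)) = (t : EReal) :=
  le_antisymm
    (iInf₂_le_of_le v h.left_mem h.iSup_rayleigh.le)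
    (le_iInf₂ fun w hw => le_iSup₂_of_le u h.right_mem
      (by rw [h.rayleigh_right (interior_orthant_subset hw)]))

lemma IsPerron.isRightQuasi (h : IsPerron A t u.ofLp v.ofLp) : IsRightQuasi (orthant n) A u :=
  ⟨interior_orthant_subset h.right_mem, by rw [h.upperQ_eq, h.iInf_rayleigh]⟩

lemma IsPerron.isLeftQuasi (h : IsPerron A t u.ofLp v.ofLp) : IsLeftQuasi (orthant n) A v :=
  ⟨interior_orthant_subset h.left_mem, by rw [h.lowerQ_eq, h.iSup_rayleigh]⟩

/-- Attaining the supremum `t` says `⟨A w - t w, y⟩ ≥ 0` for every positive `y`, which self-duality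
turns into an entrywise inequality. -/
lemma IsPerron.eq_smul_of_isRightQuasi (h : IsPerron A t u.ofLp v.ofLp) {w : E n}
    (hw : IsRightQuasi (orthant n) A w) : ∃ a : ℝ, 0 < a ∧ w = a • u := by
  refine h.eq_smul_right hw.1 (mem_orthant_of_inner_nonneg fun y hy => ?_)
  have hle : (t : EReal) ≤ (rayleigh A w y : ℝ) := by
    rw [← h.upperQ_eq, hw.2]
    exact iInf₂_le y hy
  rw [EReal.coe_le_coe_iff, rayleigh, le_div_iff₀ (inner_pos hw.1 hy)] at hle
  rw [inner_sub_left, real_inner_smul_left]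
  exact sub_nonneg.mpr hle

lemma IsPerron.eq_smul_of_isLeftQuasi (h : IsPerron A t u.ofLp v.ofLp) {w : E n}
    (hw : IsLeftQuasi (orthant n) A w) : ∃ a : ℝ, 0 < a ∧ w = a • v := by
  refine h.eq_smul_left hw.1 (mem_orthant_of_inner_nonneg fun y hy => ?_)
  have hle : (rayleigh A y w : ℝ) ≤ (t : EReal) := by
    rw [← h.lowerQ_eq, hw.2]
    exact le_iSup₂ (f := fun (u : E n) (_ : u ∈ interior (orthant n)) =>
      ((rayleigh A u w : ℝ) : EReal)) y hy
  rw [EReal.coe_le_coe_iff, rayleigh, div_le_iff₀ (inner_pos' hy hw.1), inner_op_left] at hle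
  rw [inner_sub_left, real_inner_smul_left, real_inner_comm, real_inner_comm _ (op _ _)]
  exact sub_nonneg.mpr hle

lemma IsPerron.isSaddle (h : IsPerron A t u.ofLp v.ofLp) : IsSaddle (orthant n) A u v := by
  have huv : inner ℝ u v ≠ (0 : ℝ) :=
    (inner_pos' h.right_mem (interior_orthant_subset h.left_mem)).ne'
  have hr : rayleigh A u v = t := rayleigh_of_right h.op_right huv
  refine ⟨h.isRightQuasi, h.isLeftQuasi, huv, ?_, ?_, by rw [hr, h.upperQ_eq],
    by rw [hr, h.lowerQ_eq]⟩
  -- `λ(·,v)` equals `t` on the whole open set where the denominator is nonzero, not only on the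
  -- cone.
  · refine (hasFDerivAt_const t u).congr_of_eventuallyEq ?_
    have hc : Continuous fun x : E n => (inner ℝ x v : ℝ) := by fun_prop
    filter_upwards [hc.continuousAt.eventually_ne huv] with x hx
    exact rayleigh_of_left h.op_left hx
  · refine (hasFDerivAt_const t v).congr_of_eventuallyEq ?_
    have hc : Continuous fun y : E n => (inner ℝ u y : ℝ) := by fun_prop
    filter_upwards [hc.continuousAt.eventually_ne huv] with y hy
    exact rayleigh_of_right h.op_right hy

lemma IsPerron.isSaddle_iff (h : IsPerron A t u.ofLp v.ofLp) (u' v' : E n) :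
    IsSaddle (orthant n) A u' v' ↔ ∃ a b : ℝ, 0 < a ∧ 0 < b ∧ u' = a • u ∧ v' = b • v := by
  constructor
  · intro hs
    obtain ⟨a, ha, hu⟩ := h.eq_smul_of_isRightQuasi hs.right
    obtain ⟨b, hb, hv⟩ := h.eq_smul_of_isLeftQuasi hs.left
    exact ⟨a, b, ha, hb, hu, hv⟩
  · rintro ⟨a, b, ha, hb, rfl, rfl⟩
    exact (h.smul ha hb).isSaddle

/-- Upper bounds for both quasi-eigenvalues of a perturbation, from the left eigenvector. -/
lemma IsPerron.quasi_add_le (h : IsPerron A t u.ofLp v.ofLp) {D : Matrix (Fin n) (Fin n) ℝ}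
    {c : ℝ} (hc : ∀ w ∈ orthant n \ {0}, rayleigh D w v ≤ c) :
    lowerQ (orthant n) (A + D) ≤ ((t + c : ℝ) : EReal) ∧
      upperQ (orthant n) (A + D) ≤ ((t + c : ℝ) : EReal) := by
  have key : ∀ w ∈ orthant n \ {0}, rayleigh (A + D) w v ≤ t + c := fun w hw => by
    rw [rayleigh_add_of_left D h.op_left (inner_pos hw h.left_mem).ne']
    linarith [hc w hw]
  exact ⟨lowerQ_le (interior_orthant_subset h.left_mem) fun w hw =>
    key w (interior_orthant_subset hw), upperQ_le h.left_mem key⟩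

/-- Lower bounds for both quasi-eigenvalues of a perturbation, from the right eigenvector. -/
lemma IsPerron.le_quasi_add (h : IsPerron A t u.ofLp v.ofLp) {D : Matrix (Fin n) (Fin n) ℝ}
    {c : ℝ} (hc : ∀ w ∈ orthant n \ {0}, c ≤ rayleigh D u w) :
    ((t + c : ℝ) : EReal) ≤ lowerQ (orthant n) (A + D) ∧
      ((t + c : ℝ) : EReal) ≤ upperQ (orthant n) (A + D) := by
  have key : ∀ w ∈ orthant n \ {0}, t + c ≤ rayleigh (A + D) u w := fun w hw => by
    rw [rayleigh_add_of_right D h.op_right (inner_pos' h.right_mem hw).ne']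
    linarith [hc w hw]
  exact ⟨le_lowerQ h.right_mem key, le_upperQ (interior_orthant_subset h.right_mem) fun w hw =>
    key w (interior_orthant_subset hw)⟩

/-- Upper bounds test with `v` and cost the secant bound `c₁`; lower bounds test with `u` and cost
`c₂`. Neither constant involves `D`. -/
lemma IsPerron.lipschitz (h : IsPerron A t u.ofLp v.ofLp) : ∃ c₁ c₂ : ℝ,
    IsLUB ((fun w : E n => ‖w‖ * ‖v‖ / inner ℝ w v) '' (orthant n \ {0})) c₁ ∧
    IsLUB ((fun w : E n => ‖u‖ * ‖w‖ / inner ℝ u w) '' (orthant n \ {0})) c₂ ∧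
    ∀ D : Matrix (Fin n) (Fin n) ℝ, ∃ lo up : ℝ,
      lowerQ (orthant n) (A + D) = (lo : EReal) ∧
      upperQ (orthant n) (A + D) = (up : EReal) ∧
      max |lo - t| |up - t| ≤ max c₁ c₂ * ‖op D‖ := by
  obtain ⟨c₁, hc₁⟩ := exists_isLUB_secant h.left_mem
  obtain ⟨c₂, hc₂⟩ := exists_isLUB_secant h.right_mem
  have hswap : (fun w : E n => ‖u‖ * ‖w‖ / inner ℝ u w) =
      fun w : E n => ‖w‖ * ‖u‖ / inner ℝ w u := by
    funext w
    rw [mul_comm, real_inner_comm]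
  rw [← hswap] at hc₂
  refine ⟨c₁, c₂, hc₁, hc₂, fun D => ?_⟩
  have hup := h.quasi_add_le (D := D) (c := c₁ * ‖op D‖) fun w hw =>
    (le_abs_self _).trans <| (abs_rayleigh_le D (inner_pos hw h.left_mem)).trans <|
      mul_le_mul_of_nonneg_right (hc₁.1 ⟨w, hw, rfl⟩) (norm_nonneg _)
  have hlo := h.le_quasi_add (D := D) (c := -(c₂ * ‖op D‖)) fun w hw =>
    neg_le_of_neg_le <| (neg_le_abs _).trans <|
      (abs_rayleigh_le D (inner_pos' h.right_mem hw)).trans <|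
      mul_le_mul_of_nonneg_right (hc₂.1 ⟨w, hw, rfl⟩) (norm_nonneg _)
  obtain ⟨lo, hlo_eq, hlo_le⟩ := exists_abs_sub_le_of_mem_Icc (norm_nonneg (op D)) hlo.1 hup.1
  obtain ⟨up, hup_eq, hup_le⟩ := exists_abs_sub_le_of_mem_Icc (norm_nonneg (op D)) hlo.2 hup.2
  exact ⟨lo, up, hlo_eq, hup_eq, max_le hlo_le hup_le⟩

lemma IsPerron.le_quasi_add_of_nonneg (h : IsPerron A t u.ofLp v.ofLp)
    {D : Matrix (Fin n) (Fin n) ℝ} (hD : ∀ i j, 0 ≤ D i j) :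
    (t : EReal) ≤ lowerQ (orthant n) (A + D) ∧ (t : EReal) ≤ upperQ (orthant n) (A + D) := by
  simpa using h.le_quasi_add (D := D) (c := 0) fun w hw =>
    rayleigh_nonneg hD (interior_subset h.right_mem) hw.1

lemma IsPerron.quasi_add_le_of_nonpos (h : IsPerron A t u.ofLp v.ofLp)
    {D : Matrix (Fin n) (Fin n) ℝ} (hD : ∀ i j, D i j ≤ 0) :
    lowerQ (orthant n) (A + D) ≤ (t : EReal) ∧ upperQ (orthant n) (A + D) ≤ (t : EReal) := by
  simpa using h.quasi_add_le (D := D) (c := 0) fun w hw => by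
    have := rayleigh_nonneg (D := -D) (fun i j => by simpa using hD i j) hw.1
      (interior_subset h.left_mem)
    rw [rayleigh_neg] at this
    linarith

end PerronPair

end QuasiEig

theorem theorem3 (n : ℕ) (hn : 0 < n) (A : Matrix (Fin n) (Fin n) ℝ) (hA : QuasiEig.Isc A) :
    ∃ lam : ℝ,
      -- the quasi-eigenvalues coincide; their common value is also the minimax value on
      -- pairs of positive vectors
      QuasiEig.upperQ (QuasiEig.orthant n) A = (lam : EReal) ∧
      QuasiEig.lowerQ (QuasiEig.orthant n) A = (lam : EReal) ∧
      (⨆ u ∈ interior (QuasiEig.orthant n), ⨅ v ∈ interior (QuasiEig.orthant n),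
        ((QuasiEig.rayleigh A u v : ℝ) : EReal)) = (lam : EReal) ∧
      (⨅ v ∈ interior (QuasiEig.orthant n), ⨆ u ∈ interior (QuasiEig.orthant n),
        ((QuasiEig.rayleigh A u v : ℝ) : EReal)) = (lam : EReal) ∧
      -- it is an (algebraically) simple eigenvalue
      A.charpoly.rootMultiplicity lam = 1 ∧
      -- right and left quasi-eigenvectors exist
      (∃ u, QuasiEig.IsRightQuasi (QuasiEig.orthant n) A u) ∧
      (∃ v, QuasiEig.IsLeftQuasi (QuasiEig.orthant n) A v) ∧
      -- they are positive eigenvectors and form a saddle point, unique up to multipliers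
      (∀ u v : QuasiEig.E n, QuasiEig.IsRightQuasi (QuasiEig.orthant n) A u →
        QuasiEig.IsLeftQuasi (QuasiEig.orthant n) A v →
        (∀ i, 0 < u i) ∧ (∀ i, 0 < v i) ∧
        QuasiEig.op A u = lam • u ∧ QuasiEig.op A.transpose v = lam • v ∧
        QuasiEig.IsSaddle (QuasiEig.orthant n) A u v ∧
        (∀ u' v' : QuasiEig.E n, QuasiEig.IsSaddle (QuasiEig.orthant n) A u' v' ↔
          ∃ a b : ℝ, 0 < a ∧ 0 < b ∧ u' = a • u ∧ v' = b • v) ∧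
        -- Lipschitz estimate, with the constant given by the quasi-eigenvectors of `A`
        (∃ c₁ c₂ : ℝ,
          IsLUB ((fun w : QuasiEig.E n => ‖w‖ * ‖v‖ / inner ℝ w v) ''
            (QuasiEig.orthant n \ {0})) c₁ ∧
          IsLUB ((fun w : QuasiEig.E n => ‖u‖ * ‖w‖ / inner ℝ u w) ''
            (QuasiEig.orthant n \ {0})) c₂ ∧
          ∀ D : Matrix (Fin n) (Fin n) ℝ, ∃ lo up : ℝ,
            QuasiEig.lowerQ (QuasiEig.orthant n) (A + D) = (lo : EReal) ∧
            QuasiEig.upperQ (QuasiEig.orthant n) (A + D) = (up : EReal) ∧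
            max |lo - lam| |up - lam| ≤ max c₁ c₂ * ‖QuasiEig.op D‖)) ∧
      -- one-sided monotonicity
      (∀ D : Matrix (Fin n) (Fin n) ℝ, (∀ i j, 0 ≤ D i j) →
        (lam : EReal) ≤ QuasiEig.lowerQ (QuasiEig.orthant n) (A + D) ∧
        (lam : EReal) ≤ QuasiEig.upperQ (QuasiEig.orthant n) (A + D)) ∧
      (∀ D : Matrix (Fin n) (Fin n) ℝ, (∀ i j, D i j ≤ 0) →
        QuasiEig.lowerQ (QuasiEig.orthant n) (A + D) ≤ (lam : EReal) ∧
        QuasiEig.upperQ (QuasiEig.orthant n) (A + D) ≤ (lam : EReal)) := by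
  have : Nonempty (Fin n) := ⟨⟨0, hn⟩⟩
  obtain ⟨t, x, y, hxy⟩ := hA.exists_isPerron hn
  have h : QuasiEig.IsPerron A t (WithLp.toLp 2 x : QuasiEig.E n).ofLp
      (WithLp.toLp 2 y : QuasiEig.E n).ofLp := hxy
  refine ⟨t, h.upperQ_eq, h.lowerQ_eq, h.iSup_iInf_rayleigh, h.iInf_iSup_rayleigh,
    h.rootMultiplicity_charpoly, ⟨_, h.isRightQuasi⟩, ⟨_, h.isLeftQuasi⟩, fun u v hu hv => ?_,
    fun _ => h.le_quasi_add_of_nonneg, fun _ => h.quasi_add_le_of_nonpos⟩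
  -- Arbitrary quasi-eigenvectors are positive multiples of the Perron vectors, so they form a
  -- Perron pair themselves and every earlier result applies to them directly.
  obtain ⟨a, ha, rfl⟩ := h.eq_smul_of_isRightQuasi hu
  obtain ⟨b, hb, rfl⟩ := h.eq_smul_of_isLeftQuasi hv
  have h' := h.smul ha hb
  exact ⟨h'.right_pos, h'.left_pos, h'.op_right, h'.op_left, h'.isSaddle, h'.isSaddle_iff,
    h'.lipschitz⟩
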